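/- Let $\operatorname{crank}(\lambda)$ be the crank of a partition $\lambda$: if $\mu(\lambda)$ is the number of ones in $\lambda$ and $\nu(\lambda)$ the number of parts larger than $\mu(\lambda)$, then $\operatorname{crank}(\lambda)$ is the largest part of $\lambda$ if $\mu(\lambda)=0$ (and $0$ for the empty partition), and $\nu(\lambda)-\mu(\lambda)$ if $\mu(\lambda)>0$. For $m\in\mathbb Z$ and $n\ge 0$, $n\neq 1$, let $M(m,n)$ be the number of partitions of $n$ with crank $m$; for $n=1$ use the customary convention $M(1,1)=M(-1,1)=1$, $M(0,1)=-1$ and $M(m,1)=0$ for all other $m$. For $|q|<1$ put $$(q)_\infty=\prod_{n\ge1}(1-q^n),\qquad C_k(q)=\sum_{n\ge0}\Bigl(\sum_{m\in\mathbb Z}m^kM(m,n)\Bigr)q^n,\qquad \mathcal C_k(q)=(q)_\infty C_k(q).$$ For $\tau$ in the upper half-plane, $q=e^{2\pi i\tau}$ and $k\ge1$, put $$G_{2k}(\tau)=-\frac{B_{2k}}{4k}+\sum_{n\ge1}\sigma_{2k-1}(n)q^n,$$ where $B_{2k}$ is the Bernoulli number and $\sigma_j(n)=\sum_{d\mid n}d^j$.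 For a function $\phi$ on partitions put $$\mathrm{Tr}_k(\phi;X_1,\dots,X_k)=\sum_{\lambda\vdash k}\phi(\lambda)\prod_{j=1}^kX_j^{m_j},$$ where $m_j$ is the multiplicity of $j$ in $\lambda$, and let $\ell(\lambda)=\sum_j m_j$. For $\lambda\vdash k$, $k\ge 1$, let $$\phi_M(\lambda)=(2k)!\prod_{j=1}^k\frac{2^{m_j}}{m_j!\,((2j)!)^{m_j}},\qquad \phi_S(\lambda)=\frac{(2k)!}{2}(-1)^{\ell(\lambda)-1}(\ell(\lambda)-1)!\prod_{j=1}^k\frac1{m_j!\,((2j)!)^{m_j}}.$$ Then for every integer $k\ge1$ and every $\tau$ in the upper half-plane, with $q=e^{2\pi i\tau}$, the product $(q)_\infty$ and the series $C_{2k}(q)$ and $G_{2k}(\tau)$ converge, and $$\mathcal C_{2k}(q)=\mathrm{Tr}_k\Bigl(\phi_M;\,G_2(\tau)+\frac{B_2}{4},\,G_4(\tau)+\frac{B_4}{8},\,\dots,\,G_{2k}(\tau)+\frac{B_{2k}}{4k}\Bigr),$$ $$G_{2k}(\tau)=-\frac{B_{2k}}{4k}+\mathrm{Tr}_k\bigl(\phi_S;\,\mathcal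 C_2(q),\mathcal C_4(q),\dots,\mathcal C_{2k}(q)\bigr).$$ -/

import Mathlib

namespace CrankTrace

/-- The crank of a partition. With `μ` the number of ones and `ν` the number of parts larger
than `μ`, it is the largest part if `μ = 0` and `ν - μ` if `μ > 0`. The supremum of the multiset
of parts is the largest part; it is `0` for the empty partition. -/
def crank {n : ℕ} (p : n.Partition) : ℤ :=
  if p.parts.count 1 = 0 then (p.parts.sup : ℤ)
  else (p.parts.countP (fun a => p.parts.count 1 < a) : ℤ) - (p.parts.count 1 : ℤ)

/-- `M(m, n)`: the number of partitions of `n` with crank `m`, with the customary convention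
`M(1, 1) = M(-1, 1) = 1`, `M(0, 1) = -1` for `n = 1`, which is the one for which
`∑ M(m, n) ζ ^ m q ^ n = (q)_∞ / ((ζ q)_∞ (ζ⁻¹ q)_∞)`. -/
def crankCount (m : ℤ) (n : ℕ) : ℤ :=
  if n = 1 then (if m = 0 then -1 else if m = 1 ∨ m = -1 then 1 else 0)
  else ((Finset.univ.filter (fun p : n.Partition => crank p = m)).card : ℤ)

/-- For fixed `n`, only finitely many `M(m, n)` are nonzero, so that the sum over `m` in the
crank moments is a genuine finite sum. -/
theorem crankCount_support_finite (n : ℕ) :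
    (Function.support (fun m : ℤ => crankCount m n)).Finite := by
  by_cases hn : n = 1
  · refine (Set.toFinite ({0, 1, -1} : Set ℤ)).subset ?_
    intro m hm
    simp only [Function.mem_support, crankCount, if_pos hn] at hm
    simp only [Set.mem_insert_iff, Set.mem_singleton_iff]
    by_contra h
    push Not at h
    simp [h.1, h.2.1, h.2.2] at hm
  · refine (Set.finite_range (fun p : n.Partition => crank p)).subset ?_
    intro m hm
    simp only [Function.mem_support, crankCount, if_neg hn, ne_eq, Nat.cast_eq_zero,
      Finset.card_eq_zero] at hm
    obtain ⟨p, hp⟩ := Finset.nonempty_iff_ne_empty.mpr hm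
    exact ⟨p, (Finset.mem_filter.mp hp).2⟩

/-- The `n`-th coefficient `∑_{m ∈ ℤ} m ^ k M(m, n)` of the `k`-th crank moment. -/
noncomputable def crankMomentCoeff (k n : ℕ) : ℤ :=
  ∑ᶠ m : ℤ, m ^ k * crankCount m n

/-- `C_k(q) = ∑_{n ≥ 0} (∑_{m ∈ ℤ} m ^ k M(m, n)) q ^ n`. -/
noncomputable def crankMoment (k : ℕ) (q : ℂ) : ℂ :=
  ∑' n : ℕ, (crankMomentCoeff k n : ℂ) * q ^ n

/-- `(q)_∞ = ∏_{n ≥ 1} (1 - q ^ n)`. -/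
noncomputable def eulerProduct (q : ℂ) : ℂ :=
  ∏' n : ℕ, (1 - q ^ (n + 1))

/-- The normalized crank moment `𝓒_k(q) = (q)_∞ C_k(q)`. -/
noncomputable def normalizedCrankMoment (k : ℕ) (q : ℂ) : ℂ :=
  eulerProduct q * crankMoment k q

/-- The variable `q = e ^ (2 π i τ)`. -/
noncomputable def nome (τ : UpperHalfPlane) : ℂ :=
  Complex.exp (2 * Real.pi * Complex.I * (τ : ℂ))

/-- The Eisenstein series of weight `2 k` (for `k ≥ 1`),
`G_{2k}(τ) = - B_{2k} / (4 k) + ∑_{n ≥ 1} σ_{2k-1}(n) q ^ n`. -/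
noncomputable def eisensteinG (k : ℕ) (τ : UpperHalfPlane) : ℂ :=
  -((bernoulli (2 * k) : ℚ) : ℂ) / (4 * (k : ℂ)) +
    ∑' n : ℕ, (ArithmeticFunction.sigma (2 * k - 1) (n + 1) : ℂ) * nome τ ^ (n + 1)

/-- The partition trace `Tr_k(φ; X_1, …, X_k) = ∑_{λ ⊢ k} φ(λ) ∏_{j=1}^k X_j ^ {m_j}`, where
`m_j` is the multiplicity of `j` in `λ` and `φ` is a function on the set of all partitions. -/
noncomputable def partitionTrace (k : ℕ) (φ : (n : ℕ) → n.Partition → ℂ) (X : ℕ → ℂ) : ℂ :=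
  ∑ p : k.Partition, φ k p * ∏ j ∈ Finset.Icc 1 k, X j ^ p.parts.count j

/-- `φ_M(λ) = (2k)! ∏_{j=1}^k 2 ^ {m_j} / (m_j! (2j)! ^ {m_j})` for `λ ⊢ k`. -/
noncomputable def phiM (k : ℕ) (p : k.Partition) : ℂ :=
  ((2 * k).factorial : ℂ) * ∏ j ∈ Finset.Icc 1 k,
    (2 : ℂ) ^ p.parts.count j / (((p.parts.count j).factorial : ℂ) * ((2 * j).factorial : ℂ) ^ p.parts.count j)

/-- `φ_S(λ) = ((2k)! / 2) (-1) ^ (ℓ(λ) - 1) (ℓ(λ) - 1)! ∏_{j=1}^k 1 / (m_j! (2j)! ^ {m_j})` for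
`λ ⊢ k` and `k ≥ 1`, where `ℓ(λ) ≥ 1` is the number of parts. -/
noncomputable def phiS (k : ℕ) (p : k.Partition) : ℂ :=
  ((2 * k).factorial : ℂ) / 2 * (-1) ^ (p.parts.card - 1) * ((p.parts.card - 1).factorial : ℂ) *
    ∏ j ∈ Finset.Icc 1 k,
      1 / (((p.parts.count j).factorial : ℂ) * ((2 * j).factorial : ℂ) ^ p.parts.count j)

end CrankTrace

/-!
The crank generating function has the product form of Andrews and Garvan,
`∑ M(m, n) z ^ m q ^ n = (q)_∞ / ((z q)_∞ (z⁻¹ q)_∞)`. Indeed, the partitions with exactly `J` ones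
contribute `(1 - q) (z⁻¹ q) ^ J / (∏_{i ≤ J} (1 - q ^ i) ∏_{i > J} (1 - z q ^ i))` (up to a
correction for `J = 0` that the convention for `n = 1` cancels), and these terms are summed by the
`q`-binomial theorem, modulo each power of `q`.

At `z = exp u` the series becomes the exponential generating function in `u` of the crank moments.
The logarithmic derivative of the product form in `z` then shows that
`y = ∑ 𝓒_{2n} / (2n)! X ^ n` and `g = ∑ 2 (G_{2j} + B_{2j} / (4j)) / (2j)! X ^ j` satisfy
`y' = g' y`, that is `y = exp g` and `g = log y`. Expanding the exponential and the logarithm over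
partitions gives the two trace formulas.
-/

namespace CrankTrace

open Finset PowerSeries
open scoped Nat

section PartitionSum

variable {R : Type*} [CommSemiring R]

/-- The power series `∑ₙ (∑_{λ ⊢ n} g(λ)) Xⁿ`, where `g` is a function of the multiset of parts. -/
noncomputable def partitionSum (g : Multiset ℕ → R) : R⟦X⟧ :=
  .mk fun n => ∑ p : n.Partition, g p.parts

theorem coeff_partitionSum (g : Multiset ℕ → R) (n : ℕ) :
    coeff n (partitionSum g) = ∑ p : n.Partition, g p.parts := coeff_mk _ _

theorem coeff_zero_partitionSum (g : Multiset ℕ → R) : coeff 0 (partitionSum g) = g 0 := by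
  simp [coeff_partitionSum]

theorem partitionSum_add (g h : Multiset ℕ → R) :
    partitionSum (fun s => g s + h s) = partitionSum g + partitionSum h := by
  ext n
  simp [coeff_partitionSum, sum_add_distrib]

theorem partitionSum_const_mul (c : R) (g : Multiset ℕ → R) :
    partitionSum (fun s => c * g s) = C c * partitionSum g := by
  ext n
  simp [coeff_partitionSum, mul_sum]

theorem partitionSum_ite_mem {a : ℕ} (ha : 1 ≤ a) (g : Multiset ℕ → R) :
    partitionSum (fun s => if a ∈ s then g s else 0) =
      X ^ a * partitionSum fun s => g (a ::ₘ s) := by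
  ext n
  rw [coeff_partitionSum, ← sum_filter, coeff_X_pow_mul']
  split_ifs with han
  · rw [coeff_partitionSum, ← sum_subtype_eq_sum_filter, subtype_univ]
    refine Fintype.sum_equiv (Nat.Partition.partitionWithPartEquiv ha han) _ _ fun p => ?_
    rw [Nat.Partition.partitionWithPartEquiv_apply_parts, Multiset.cons_erase p.2]
  · exact sum_eq_zero fun p hp => absurd (p.le_of_mem_parts (mem_filter.mp hp).2) han

theorem partitionSum_count_mul {a : ℕ} (ha : 1 ≤ a) (g : Multiset ℕ → R) :
    partitionSum (fun s => s.count a * g s) =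
      X ^ a * partitionSum fun s => (s.count a + 1) * g (a ::ₘ s) := by
  have hmem (s : Multiset ℕ) :
      (s.count a : R) * g s = if a ∈ s then (s.count a : R) * g s else 0 := by
    split_ifs with h
    · rfl
    · rw [Multiset.count_eq_zero_of_notMem h, Nat.cast_zero, zero_mul]
  rw [funext hmem, partitionSum_ite_mem ha]
  simp only [Multiset.count_cons_self, Nat.cast_succ]

theorem toFinset_parts_subset_Icc {n : ℕ} (p : n.Partition) : p.parts.toFinset ⊆ Icc 1 n :=
  fun _ ha => mem_Icc.mpr ⟨p.parts_pos (Multiset.mem_toFinset.mp ha),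
    p.le_of_mem_parts (Multiset.mem_toFinset.mp ha)⟩

theorem card_parts_ne_zero {n : ℕ} (hn : n ≠ 0) (p : n.Partition) : p.parts.card ≠ 0 :=
  fun h => hn <| by rw [← p.parts_sum, Multiset.card_eq_zero.mp h, Multiset.sum_zero]

theorem coeff_partitionSum_sum_map_mul (h : ℕ → R) (g : Multiset ℕ → R) (n : ℕ) :
    coeff n (partitionSum fun s => (s.map h).sum * g s) =
      ∑ a ∈ Icc 1 n, h a * coeff n (partitionSum fun s => s.count a * g s) := by
  simp only [coeff_partitionSum, mul_sum]
  rw [sum_comm]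
  refine sum_congr rfl fun p _ => ?_
  rw [sum_multiset_map_count, sum_subset (toFinset_parts_subset_Icc p), sum_mul]
  · exact sum_congr rfl fun a _ => by rw [nsmul_eq_mul, mul_left_comm, mul_assoc]
  · intro a _ ha
    rw [Multiset.mem_toFinset] at ha
    rw [Multiset.count_eq_zero_of_notMem ha, zero_nsmul]

end PartitionSum

section ExponentialFormula

variable {K : Type*} [Field K]

/-- The weight `∏ⱼ cⱼ ^ mⱼ / mⱼ!` of a multiset with multiplicities `mⱼ`. -/
noncomputable def expWeight (c : ℕ → K) (s : Multiset ℕ) : K :=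
  ∏ j ∈ s.toFinset, c j ^ s.count j / (s.count j)!

theorem expWeight_eq_prod (c : ℕ → K) {s : Multiset ℕ} {t : Finset ℕ} (h : s.toFinset ⊆ t) :
    expWeight c s = ∏ j ∈ t, c j ^ s.count j / (s.count j)! := by
  refine prod_subset h fun j _ hj => ?_
  rw [Multiset.mem_toFinset] at hj
  simp [Multiset.count_eq_zero_of_notMem hj]

theorem expWeight_parts_eq_prod (c : ℕ → K) {n : ℕ} (p : n.Partition) :
    expWeight c p.parts = ∏ j ∈ Icc 1 n, c j ^ p.parts.count j / (p.parts.count j)! :=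
  expWeight_eq_prod c (toFinset_parts_subset_Icc p)

theorem succ_count_mul_expWeight_cons [CharZero K] (c : ℕ → K) (a : ℕ) (s : Multiset ℕ) :
    (s.count a + 1) * expWeight c (a ::ₘ s) = c a * expWeight c s := by
  have hne : ((s.count a : K) + 1) ≠ 0 := Nat.cast_add_one_ne_zero _
  have hrest : ∏ j ∈ s.toFinset.erase a, c j ^ (a ::ₘ s).count j / ((a ::ₘ s).count j)! =
      ∏ j ∈ s.toFinset.erase a, c j ^ s.count j / ((s.count j)! : K) :=
    prod_congr rfl fun j hj => by rw [Multiset.count_cons_of_ne (ne_of_mem_erase hj)]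
  rw [expWeight_eq_prod c (subset_insert a s.toFinset), expWeight, Multiset.toFinset_cons,
    ← mul_prod_erase _ _ (mem_insert_self a _), ← mul_prod_erase _ _ (mem_insert_self a _),
    erase_insert_eq_erase, hrest, Multiset.count_cons_self, Nat.factorial_succ, pow_succ]
  push_cast
  field_simp

/-- Faà di Bruno's series: the exponential generating function `∑ f l * T ^ l / l!` composed with
the power series `c - c(0)`. -/
noncomputable def egfComp (f : ℕ → K) (c : K⟦X⟧) : K⟦X⟧ :=
  partitionSum fun s => f s.card * expWeight (fun j => coeff j c) s

theorem coeff_zero_egfComp (f : ℕ → K) (c : K⟦X⟧) : coeff 0 (egfComp f c) = f 0 := by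
  simp [egfComp, coeff_zero_partitionSum, expWeight]

theorem egfComp_congr (f : ℕ → K) {c c' : K⟦X⟧} (h : ∀ j, 1 ≤ j → coeff j c = coeff j c') :
    egfComp f c = egfComp f c' := by
  ext n
  simp only [egfComp, coeff_partitionSum, expWeight_parts_eq_prod]
  refine sum_congr rfl fun p _ => ?_
  rw [prod_congr rfl fun j hj => by rw [h j (mem_Icc.mp hj).1]]

theorem egfComp_add (f f' : ℕ → K) (c : K⟦X⟧) :
    egfComp (fun l => f l + f' l) c = egfComp f c + egfComp f' c := by
  simp only [egfComp, add_mul, partitionSum_add]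

theorem egfComp_ite_eq_zero (c : K⟦X⟧) : egfComp (fun l => if l = 0 then 1 else 0) c = 1 := by
  ext n
  rcases eq_or_ne n 0 with rfl | hn
  · rw [coeff_zero_egfComp, if_pos rfl, coeff_zero_one]
  · rw [egfComp, coeff_partitionSum, coeff_one, if_neg hn]
    refine sum_eq_zero fun p _ => ?_
    rw [if_neg (card_parts_ne_zero hn p), zero_mul]

variable [CharZero K]

theorem partitionSum_sum_map_mul_expWeight (h f : ℕ → K) (c : K⟦X⟧) (hc : h 0 * coeff 0 c = 0) :
    partitionSum (fun s => (s.map h).sum * (f s.card * expWeight (fun j => coeff j c) s)) =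
      PowerSeries.mk (fun a => h a * coeff a c) * egfComp (fun l => f (l + 1)) c := by
  have hmark {a : ℕ} (ha : 1 ≤ a) :
      partitionSum (fun s => s.count a * (f s.card * expWeight (fun j => coeff j c) s)) =
        X ^ a * (C (coeff a c) * egfComp (fun l => f (l + 1)) c) := by
    rw [partitionSum_count_mul ha, egfComp, ← partitionSum_const_mul]
    congr 2 with s
    rw [mul_left_comm, succ_count_mul_expWeight_cons, Multiset.card_cons, mul_left_comm]
  ext n
  rw [coeff_partitionSum_sum_map_mul, coeff_mul, Nat.sum_antidiagonal_eq_sum_range_succ_mk,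
    range_eq_Ico, sum_eq_sum_Ico_succ_bot n.succ_pos]
  simp only [coeff_mk, hc, zero_mul, zero_add]
  refine sum_congr rfl fun a ha => ?_
  obtain ⟨h1, h2⟩ := mem_Icc.mp ha
  rw [hmark h1, coeff_X_pow_mul', if_pos h2, coeff_C_mul, mul_assoc]

theorem derivative_egfComp (f : ℕ → K) (c : K⟦X⟧) :
    d⁄dX K (egfComp f c) = d⁄dX K c * egfComp (fun l => f (l + 1)) c := by
  have hX : PowerSeries.mk (fun a => (a : K) * coeff a c) = X * d⁄dX K c := by
    ext (_ | n)
    · simp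
    · rw [coeff_mk, coeff_succ_X_mul, coeff_derivative, mul_comm, Nat.cast_succ]
  have h := partitionSum_sum_map_mul_expWeight (fun a => (a : K)) f c (by simp)
  ext n
  have hn := congrArg (coeff (n + 1)) h
  rw [hX, mul_assoc, coeff_succ_X_mul, coeff_partitionSum] at hn
  rw [← hn, coeff_derivative, egfComp, coeff_partitionSum, sum_mul]
  refine sum_congr rfl fun p _ => ?_
  have hp : (p.parts.map (Nat.cast : ℕ → K)).sum = n + 1 := by
    rw [← Nat.cast_multiset_sum, p.parts_sum, Nat.cast_succ]
  rw [hp, mul_comm]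

theorem mul_egfComp_succ (f : ℕ → K) {c : K⟦X⟧} (hc : coeff 0 c = 0) :
    c * egfComp (fun l => f (l + 1)) c = egfComp (fun l => l * f l) c := by
  have h := partitionSum_sum_map_mul_expWeight (fun _ => 1) f c (by rw [hc, mul_zero])
  simp only [one_mul, Multiset.map_const', Multiset.sum_replicate, nsmul_one] at h
  have hmk : PowerSeries.mk (fun a => coeff a c) = c := by ext; simp
  rw [hmk] at h
  rw [← h]
  simp only [egfComp, mul_assoc]

/-- The **exponential formula**; the hypotheses say that `y = exp (g - g(0))`. -/
theorem eq_egfComp_one {g y : K⟦X⟧} (hy : coeff 0 y = 1) (h : d⁄dX K y = d⁄dX K g * y) :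
    y = egfComp (fun _ => 1) g := by
  have he := derivative_egfComp (fun _ => 1) g
  have he₀ : coeff 0 (egfComp (fun _ => 1) g) = 1 := coeff_zero_egfComp _ _
  set e := egfComp (fun _ => 1) g
  rw [coeff_zero_eq_constantCoeff_apply] at hy he₀
  have hinv : e * e⁻¹ = 1 := PowerSeries.mul_inv_cancel e (by rw [he₀]; exact one_ne_zero)
  have hquot : y * e⁻¹ = 1 := by
    refine derivative.ext ?_ (by simp [hy, he₀])
    rw [Derivation.leibniz, derivative_inv', h, he, derivative_one, smul_eq_mul, smul_eq_mul]
    linear_combination (-d⁄dX K g * y * e⁻¹) * hinv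
  linear_combination e * hquot - y * hinv

/-- The inverse of `eq_egfComp_one`: the coefficients of `g - g(0) = log y`. -/
theorem coeff_eq_coeff_egfComp_log {g y : K⟦X⟧} (hy : coeff 0 y = 1)
    (h : d⁄dX K y = d⁄dX K g * y) {n : ℕ} (hn : 1 ≤ n) :
    coeff n g = coeff n (egfComp (fun l => (-1) ^ (l - 1) * ((l - 1)! : K)) y) := by
  rw [egfComp_congr _ (c' := y - 1) fun j hj => by
    rw [map_sub, coeff_one, if_neg (by omega), sub_zero]]
  set c := y - 1 with hc
  have hlog := derivative_egfComp (fun l => (-1) ^ (l - 1) * ((l - 1)! : K)) c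
  have hmul := mul_egfComp_succ (fun l => (-1) ^ (l - 1) * ((l - 1)! : K)) (c := c) (by
    rw [hc, map_sub, hy, coeff_zero_one, sub_self])
  have hone := egfComp_add (fun l => l * ((-1) ^ (l - 1) * ((l - 1)! : K)))
    (fun l => (-1) ^ l * (l ! : K)) c
  have hsum (l : ℕ) : l * ((-1) ^ (l - 1) * ((l - 1)! : K)) + (-1) ^ l * (l ! : K) =
      if l = 0 then 1 else 0 := by
    rcases l with _ | l
    · simp
    · rw [if_neg l.succ_ne_zero, Nat.factorial_succ, Nat.add_sub_cancel]
      push_cast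
      ring
  simp only [Nat.add_sub_cancel, hsum, egfComp_ite_eq_zero] at hlog hmul hone
  have hderiv : d⁄dX K (egfComp (fun l => (-1) ^ (l - 1) * ((l - 1)! : K)) c) = d⁄dX K g := by
    rw [hlog, hc, map_sub, derivative_one, sub_zero, h]
    rw [hc] at hmul hone
    linear_combination d⁄dX K g * (hmul - hone)
  obtain ⟨m, rfl⟩ := Nat.exists_eq_add_of_le' hn
  have hcoeff := congrArg (coeff m) hderiv
  rw [coeff_derivative, coeff_derivative] at hcoeff
  exact (mul_right_cancel₀ (Nat.cast_add_one_ne_zero m) hcoeff).symm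

end ExponentialFormula

section Trace

theorem partitionTrace_phiM (k : ℕ) (x : ℕ → ℂ) :
    partitionTrace k phiM x =
      (2 * k)! * coeff k (egfComp (fun _ => 1) (.mk fun j => 2 * x j / (2 * j)!)) := by
  simp only [egfComp, coeff_partitionSum, coeff_mk, partitionTrace, mul_sum, phiM,
    expWeight_parts_eq_prod]
  refine sum_congr rfl fun p _ => ?_
  rw [one_mul, mul_assoc, ← prod_mul_distrib]
  congr 2 with j
  rw [div_pow, mul_pow, div_mul_eq_mul_div, div_div, mul_comm (Nat.cast _)]

theorem partitionTrace_phiS (k : ℕ) (x : ℕ → ℂ) :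
    partitionTrace k phiS x = (2 * k)! / 2 * coeff k
      (egfComp (fun l => (-1) ^ (l - 1) * ((l - 1)! : ℂ)) (.mk fun j => x j / (2 * j)!)) := by
  simp only [egfComp, coeff_partitionSum, coeff_mk, partitionTrace, mul_sum, phiS,
    expWeight_parts_eq_prod]
  refine sum_congr rfl fun p _ => ?_
  rw [mul_assoc _ (∏ j ∈ _, _), ← prod_mul_distrib, mul_assoc, mul_assoc, mul_assoc]
  congr 4 with j
  rw [div_pow, one_div_mul_eq_div, div_div, mul_comm (Nat.cast _)]

end Trace

section WeightSeries

variable {R : Type*} [CommRing R]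

/-- The series `∏_{i ≥ 1} (1 - x i * X ^ i)⁻¹`, as the sum over partitions of the product of the
weights `x i` of the parts `i`. -/
noncomputable def weightSeries (x : ℕ → R) : R⟦X⟧ :=
  partitionSum fun s => (s.map x).prod

theorem prod_map_update_zero (x : ℕ → R) (a : ℕ) (s : Multiset ℕ) :
    (s.map (Function.update x a 0)).prod = if a ∈ s then 0 else (s.map x).prod := by
  split_ifs with ha
  · exact Multiset.prod_eq_zero
      (Multiset.mem_map.mpr ⟨a, ha, Function.update_self a (0 : R) x⟩)
  · refine congrArg _ (Multiset.map_congr rfl fun i hi => ?_)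
    exact Function.update_of_ne (ne_of_mem_of_not_mem hi ha) _ _

theorem one_sub_mul_weightSeries (x : ℕ → R) {a : ℕ} (ha : 1 ≤ a) :
    (1 - C (x a) * X ^ a) * weightSeries x = weightSeries (Function.update x a 0) := by
  have hsplit := partitionSum_add (fun s => (s.map (Function.update x a 0)).prod)
    (fun s => if a ∈ s then (s.map x).prod else 0)
  have hpoint (s : Multiset ℕ) : (s.map (Function.update x a 0)).prod +
      (if a ∈ s then (s.map x).prod else 0) = (s.map x).prod := by
    rw [prod_map_update_zero]
    split_ifs <;> simp
  simp only [hpoint, partitionSum_ite_mem ha, Multiset.map_cons, Multiset.prod_cons,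
    partitionSum_const_mul] at hsplit
  rw [weightSeries, weightSeries]
  linear_combination hsplit

theorem coeff_weightSeries_congr {x x' : ℕ → R} {n : ℕ} (h : ∀ i ≤ n, x i = x' i) :
    coeff n (weightSeries x) = coeff n (weightSeries x') := by
  simp only [weightSeries, coeff_partitionSum]
  exact sum_congr rfl fun p _ => congrArg _ <|
    Multiset.map_congr rfl fun i hi => h i (p.le_of_mem_parts hi)

theorem coeff_zero_weightSeries (x : ℕ → R) : coeff 0 (weightSeries x) = 1 := by
  simp [weightSeries, coeff_zero_partitionSum]

theorem weightSeries_zero : weightSeries (fun _ => (0 : R)) = 1 := by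
  ext n
  rw [weightSeries, coeff_partitionSum, coeff_one]
  rcases eq_or_ne n 0 with rfl | hn
  · simp
  · rw [if_neg hn]
    refine sum_eq_zero fun p _ => ?_
    rw [Multiset.map_const', Multiset.prod_replicate, zero_pow (card_parts_ne_zero hn p)]

/-- The series `∏_{1 ≤ i ≤ J} (1 - y * X ^ i)⁻¹ * ∏_{i > J} (1 - z * X ^ i)⁻¹`. -/
noncomputable def stepSeries (y z : R) (J : ℕ) : R⟦X⟧ :=
  weightSeries fun i => if i ≤ J then y else z

theorem one_sub_mul_stepSeries_succ (y z : R) (J : ℕ) :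
    (1 - C y * X ^ (J + 1)) * stepSeries y z (J + 1) =
      (1 - C z * X ^ (J + 1)) * stepSeries y z J := by
  have hy := one_sub_mul_weightSeries (fun i => if i ≤ J + 1 then y else z) J.succ_pos
  have hz := one_sub_mul_weightSeries (fun i => if i ≤ J then y else z) J.succ_pos
  simp only [Nat.succ_eq_add_one, le_refl, if_true, add_le_iff_nonpos_right, nonpos_iff_eq_zero,
    one_ne_zero, if_false] at hy hz
  rw [stepSeries, stepSeries, hy, hz]
  congr 1
  ext i
  rcases eq_or_ne i (J + 1) with rfl | hi
  · simp
  · rw [Function.update_of_ne hi, Function.update_of_ne hi]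
    exact if_congr (by omega) rfl rfl

theorem coeff_stepSeries_of_le (y z : R) {n J : ℕ} (h : n ≤ J) :
    coeff n (stepSeries y z J) = coeff n (weightSeries fun _ => y) :=
  coeff_weightSeries_congr fun _ hi => if_pos (hi.trans h)

theorem stepSeries_zero (y z : R) : stepSeries y z 0 = weightSeries fun _ => z := by
  ext n
  simp only [stepSeries, weightSeries, coeff_partitionSum]
  exact sum_congr rfl fun p _ => congrArg _ <|
    Multiset.map_congr rfl fun i hi => if_neg (p.parts_pos hi).not_ge

end WeightSeries

section QBinomial

variable {B : Type*} [CommRing B]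

/-- The `q`-Pochhammer symbol `(a; q)ₙ`. -/
def qPochhammer (a q : B) (n : ℕ) : B :=
  ∏ i ∈ range n, (1 - a * q ^ i)

theorem one_sub_mul_qPochhammer (q : B) (n : ℕ) :
    (1 - q) * qPochhammer (q * q) q n = qPochhammer q q n * (1 - q * q ^ n) := by
  rw [qPochhammer, qPochhammer, ← prod_range_succ, prod_range_succ', pow_zero, mul_one, mul_comm]
  simp only [pow_succ', mul_assoc]

theorem one_sub_mul_sum_range {a q : B} {c : ℕ → B}
    (hc : ∀ n, (1 - q ^ (n + 1)) * c (n + 1) = (1 - a * q ^ n) * c n) (t : B) (N : ℕ) :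
    (1 - t) * ∑ n ∈ range N, c n * t ^ n =
      (1 - a * t) * ∑ n ∈ range N, c n * (t * q) ^ n - (1 - q ^ N) * c N * t ^ N := by
  induction N with
  | zero => simp
  | succ N ih =>
    rw [sum_range_succ, sum_range_succ, mul_pow, mul_add, ih]
    linear_combination t ^ (N + 1) * hc N

/-- The **`q`-binomial theorem**: `c n` stands for `c 0 * (a; q)ₙ / (q; q)ₙ`, and nilpotency of `q`
and `t` turns the infinite series and products into finite ones. -/
theorem qPochhammer_mul_sum_range {a q t : B} {c : ℕ → B} {N : ℕ} (hq : q ^ N = 0)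
    (ht : t ^ N = 0) (hc : ∀ n, (1 - q ^ (n + 1)) * c (n + 1) = (1 - a * q ^ n) * c n) :
    qPochhammer t q N * ∑ n ∈ range N, c n * t ^ n = qPochhammer (a * t) q N * c 0 := by
  have hiter (k : ℕ) : qPochhammer t q k * ∑ n ∈ range N, c n * t ^ n =
      qPochhammer (a * t) q k * ∑ n ∈ range N, c n * (t * q ^ k) ^ n := by
    induction k with
    | zero => simp [qPochhammer]
    | succ k ih =>
      have hstep := one_sub_mul_sum_range hc (t * q ^ k) N
      rw [mul_pow t, ht, zero_mul, mul_zero, sub_zero, mul_assoc t, ← pow_succ] at hstep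
      rw [qPochhammer, qPochhammer, prod_range_succ, prod_range_succ, ← qPochhammer, ← qPochhammer]
      linear_combination (1 - t * q ^ k) * ih + qPochhammer (a * t) q k * hstep
  rw [hiter, hq, mul_zero]
  rcases N with _ | N
  · have : Subsingleton B := subsingleton_of_zero_eq_one (by simpa using hq.symm)
    exact Subsingleton.elim _ _
  · simp [sum_range_succ']

end QBinomial

section Truncation

variable {R B : Type*} [CommRing R] [CommRing B] {ψ : R⟦X⟧ →+* B} {N : ℕ}

theorem map_eq_map_of_coeff_eq (hψ : ψ X ^ N = 0) {f g : R⟦X⟧}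
    (h : ∀ n < N, coeff n f = coeff n g) : ψ f = ψ g := by
  have hdvd : X ^ N ∣ f - g :=
    X_pow_dvd_iff.mpr fun n hn => by rw [map_sub, h n hn, sub_self]
  obtain ⟨r, hr⟩ := hdvd
  rw [← sub_eq_zero, ← map_sub, hr, map_mul, map_pow, hψ, zero_mul]

theorem mk_span_X_pow_pow_eq_zero (N : ℕ) :
    Ideal.Quotient.mk (Ideal.span {(X : R⟦X⟧) ^ N}) X ^ N = 0 := by
  rw [← map_pow, Ideal.Quotient.eq_zero_iff_mem]
  exact Ideal.mem_span_singleton_self _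

theorem eq_of_forall_mk_span_X_pow_eq {f g : R⟦X⟧}
    (h : ∀ N, Ideal.Quotient.mk (Ideal.span {(X : R⟦X⟧) ^ N}) f =
      Ideal.Quotient.mk (Ideal.span {(X : R⟦X⟧) ^ N}) g) : f = g := by
  ext n
  have hn := h (n + 1)
  rw [Ideal.Quotient.eq, Ideal.mem_span_singleton, X_pow_dvd_iff] at hn
  rw [← sub_eq_zero, ← map_sub]
  exact hn n n.lt_succ_self

theorem map_partitionSum_eq_sum_fiber (hψ : ψ X ^ N = 0) (g : Multiset ℕ → R)
    {σ : Multiset ℕ → ℕ} (hσ : ∀ {n : ℕ} (p : n.Partition), σ p.parts ≤ n) :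
    ψ (partitionSum g) =
      ∑ m ∈ range N, ψ (partitionSum fun s => if σ s = m then g s else 0) := by
  rw [← map_sum]
  refine map_eq_map_of_coeff_eq hψ fun n hn => ?_
  simp only [map_sum, coeff_partitionSum]
  rw [sum_comm]
  refine sum_congr rfl fun p _ => ?_
  rw [sum_ite_eq, if_pos (mem_range.mpr ((hσ p).trans_lt hn))]

theorem qPochhammer_mul_map_weightSeries (hψ : ψ X ^ N = 0) (z : R) :
    qPochhammer (ψ (C z) * ψ X) (ψ X) N * ψ (weightSeries fun _ => z) = 1 := by
  have hprod (J : ℕ) : qPochhammer (C z * X) X J * (weightSeries fun _ => z) =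
      stepSeries 0 z J := by
    induction J with
    | zero => rw [qPochhammer, range_zero, prod_empty, one_mul, stepSeries_zero]
    | succ J ih =>
      have hstep := one_sub_mul_stepSeries_succ 0 z J
      rw [map_zero, zero_mul, sub_zero, one_mul] at hstep
      rw [hstep, ← ih, qPochhammer, qPochhammer, prod_range_succ]
      ring
  have hN : ψ (stepSeries 0 z N) = ψ 1 := map_eq_map_of_coeff_eq hψ fun n hn => by
    rw [coeff_stepSeries_of_le _ _ hn.le, weightSeries_zero]
  rw [map_one, ← hprod, map_mul] at hN
  simpa only [qPochhammer, map_prod, map_sub, map_one, map_mul, map_pow] using hN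

end Truncation

section CrankSeries

variable {R : Type*} [CommRing R]

theorem finsum_crankCount_zsmul (n : ℕ) (f : ℤ → R) :
    ∑ᶠ m, crankCount m n • f m =
      if n = 1 then f 1 + f (-1) - f 0 else ∑ p : n.Partition, f (crank p) := by
  split_ifs with hn
  · rw [finsum_eq_sum_of_support_subset (s := {1, -1, 0}) _ fun m hm => ?_]
    · simp only [Int.reduceNeg, crankCount, hn, ↓reduceIte, ite_smul, neg_smul, one_smul,
        zero_smul, mem_insert, reduceCtorEq, mem_singleton, one_ne_zero, or_self, not_false_eq_true,
        sum_insert, or_false, neg_eq_zero, or_true, sum_singleton]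
      ring
    · by_contra h
      simp_all [crankCount]
  · rw [finsum_eq_sum_of_support_subset (s := univ.image fun p : n.Partition => crank p) _
      fun m hm => ?_]
    · rw [sum_comp f]
      simp only [crankCount, hn, if_false, natCast_zsmul]
    · by_contra h
      have hcount : crankCount m n = 0 := by
        rw [crankCount, if_neg hn, Nat.cast_eq_zero, card_eq_zero, filter_eq_empty_iff]
        intro p _ hp
        exact h (by simp [← hp])
      simp [hcount] at hm

/-- The two-variable generating function `∑ₙ (∑ₘ M(m, n) z ^ m) Xⁿ` of the crank. -/
noncomputable def crankSeries (z : Rˣ) : R⟦X⟧ :=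
  .mk fun n => ∑ᶠ m : ℤ, crankCount m n • ((z ^ m : Rˣ) : R)

/-- The contribution `z ^ crank(λ)` of a partition `λ` to the crank generating function, as a
function of its multiset of parts. -/
noncomputable def crankWeight (z : Rˣ) (s : Multiset ℕ) : R :=
  if s.count 1 = 0 then (z : R) ^ s.sup
  else (z⁻¹ : Rˣ) ^ s.count 1 * (z : R) ^ s.countP fun a => s.count 1 < a

theorem coe_zpow_crank (z : Rˣ) {n : ℕ} (p : n.Partition) :
    ((z ^ crank p : Rˣ) : R) = crankWeight z p.parts := by
  rw [crank, crankWeight]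
  split_ifs
  · rw [zpow_natCast, Units.val_pow_eq_pow_val]
  · rw [sub_eq_neg_add, zpow_add, zpow_neg, zpow_natCast, zpow_natCast, ← inv_pow, Units.val_mul,
      Units.val_pow_eq_pow_val, Units.val_pow_eq_pow_val]

/-- The term `(z - 1) X` comes from the convention for `M(m, 1)`. -/
theorem crankSeries_eq (z : Rˣ) :
    crankSeries z = C (z - 1 : R) * X + partitionSum (crankWeight z) := by
  ext n
  rw [crankSeries, coeff_mk, finsum_crankCount_zsmul, map_add, coeff_C_mul, coeff_X,
    coeff_partitionSum]
  split_ifs with hn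
  · subst hn
    have hcount : Multiset.countP (fun a => 1 < a) {1} = 0 := by decide
    simp only [zpow_ofNat, pow_one, Int.reduceNeg, zpow_neg, pow_zero, Units.val_one, mul_one,
      univ_unique, crankWeight, Nat.Partition.partition_one_parts, Multiset.nodup_singleton,
      Multiset.mem_singleton, Multiset.count_eq_one_of_mem, one_ne_zero, ↓reduceIte, hcount,
      sum_const, card_singleton, one_smul]
    ring
  · simp [coe_zpow_crank]

theorem partitionSum_ite_count_eq {a : ℕ} (ha : 1 ≤ a) (J : ℕ) (g : Multiset ℕ → R) :
    (partitionSum fun s => if s.count a = J then g s else 0) = X ^ (a * J) *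
      partitionSum fun s => if a ∈ s then 0 else g (Multiset.replicate J a + s) := by
  induction J generalizing g with
  | zero => simp [Multiset.count_eq_zero]
  | succ J ih =>
    have hmem (s : Multiset ℕ) : (if s.count a = J + 1 then g s else 0) =
        if a ∈ s then if s.count a = J + 1 then g s else 0 else 0 := by
      by_cases h : a ∈ s
      · rw [if_pos h]
      · simp [h]
    rw [funext hmem, partitionSum_ite_mem ha]
    simp only [Multiset.count_cons_self, Nat.add_right_cancel_iff, ih (fun s => g (a ::ₘ s)),
      ← mul_assoc, ← pow_add, Multiset.replicate_succ, Multiset.cons_add, mul_add_one,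
      Nat.add_comm a]

theorem stepSeries_one_zero (J : ℕ) :
    stepSeries (1 : R) 0 J = partitionSum fun s => if s.sup ≤ J then 1 else 0 := by
  rw [stepSeries, weightSeries]
  congr 1 with s
  induction s using Multiset.induction with
  | empty => simp
  | cons a s ih => by_cases ha : a ≤ J <;> simp [ha, ih]

theorem partitionSum_ite_sup_eq (m : ℕ) :
    (partitionSum fun s => if s.sup = m then (1 : R) else 0) = X ^ m * stepSeries 1 0 m := by
  rw [stepSeries_one_zero]
  rcases m with _ | m
  · simp
  · have hmem (s : Multiset ℕ) : (if s.sup = m + 1 then (1 : R) else 0) =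
        if m + 1 ∈ s then if s.sup ≤ m + 1 then 1 else 0 else 0 := by
      rw [← ite_and]
      refine if_congr ⟨fun h => ⟨?_, h.le⟩, fun h => h.2.antisymm (Multiset.le_sup h.1)⟩ rfl rfl
      by_contra hm
      have hle : s.sup ≤ m := Multiset.sup_le.mpr fun b hb =>
        Nat.le_of_lt_succ <| ((Multiset.le_sup hb).trans h.le).lt_of_ne (ne_of_mem_of_not_mem hb hm)
      omega
    rw [funext hmem, partitionSum_ite_mem m.succ_pos]
    simp only [Multiset.sup_cons, sup_le_iff, le_refl, true_and]

theorem partitionSum_ite_mem_zero_prod (x : ℕ → R) {a : ℕ} (ha : 1 ≤ a) :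
    (partitionSum fun s => if a ∈ s then 0 else (s.map x).prod) =
      (1 - C (x a) * X ^ a) * weightSeries x := by
  rw [one_sub_mul_weightSeries x ha, weightSeries]
  simp only [prod_map_update_zero]

theorem partitionSum_crankWeight_count_zero (z : Rˣ) :
    (partitionSum fun s => if s.count 1 = 0 then crankWeight z s else 0) =
      (1 - X) * (partitionSum fun s => (z : R) ^ s.sup) - C (z - 1 : R) * X := by
  have hsplit := partitionSum_add (fun s => if s.count 1 = 0 then crankWeight z s else 0)
    (fun s => if 1 ∈ s then (z : R) ^ s.sup else 0)
  have hall (s : Multiset ℕ) : (if s.count 1 = 0 then crankWeight z s else 0) +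
      (if 1 ∈ s then (z : R) ^ s.sup else 0) = (z : R) ^ s.sup := by
    by_cases h : 1 ∈ s <;> simp [crankWeight, h]
  have hcons (s : Multiset ℕ) : (z : R) ^ (1 ::ₘ s).sup =
      (z : R) ^ s.sup + (z - 1) * if s.sup = 0 then 1 else 0 := by
    rcases Nat.eq_zero_or_pos s.sup with h | h
    · simp [h]
    · rw [Multiset.sup_cons, sup_eq_right.mpr h, if_neg h.ne', mul_zero, add_zero]
  rw [funext hall, partitionSum_ite_mem le_rfl, funext hcons, partitionSum_add,
    partitionSum_const_mul, partitionSum_ite_sup_eq, stepSeries_zero, weightSeries_zero] at hsplit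
  linear_combination -hsplit

theorem prod_map_ite_le (z : R) (J : ℕ) (s : Multiset ℕ) :
    (s.map fun i => if i ≤ J then 1 else z).prod = z ^ s.countP fun a => J < a := by
  induction s using Multiset.induction with
  | empty => simp
  | cons a s ih => by_cases ha : a ≤ J <;> simp [ha, ih, pow_succ', not_lt.mpr, not_le.mp]

theorem partitionSum_crankWeight_count_succ (z : Rˣ) (J : ℕ) :
    (partitionSum fun s => if s.count 1 = J + 1 then crankWeight z s else 0) =
      (1 - X) * (stepSeries 1 (z : R) (J + 1) * (C ((z⁻¹ : Rˣ) : R) * X) ^ (J + 1)) := by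
  have hones (s : Multiset ℕ) :
      (if 1 ∈ s then 0 else crankWeight z (Multiset.replicate (J + 1) 1 + s)) =
        ((z⁻¹ : Rˣ) : R) ^ (J + 1) *
          if 1 ∈ s then 0 else (s.map fun i => if i ≤ J + 1 then 1 else (z : R)).prod := by
    split_ifs with h
    · rw [mul_zero]
    · have hrep : (Multiset.replicate (J + 1) 1).countP (fun a => J + 1 < a) = 0 :=
        Multiset.countP_eq_zero.mpr fun a ha => by simp [Multiset.eq_of_mem_replicate ha]
      simp only [crankWeight, Multiset.count_add, Multiset.count_replicate_self,
        Multiset.count_eq_zero_of_notMem h, add_zero, J.succ_ne_zero, if_false,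
        Multiset.countP_add, hrep, zero_add, prod_map_ite_le]
  rw [partitionSum_ite_count_eq le_rfl, funext hones, partitionSum_const_mul,
    partitionSum_ite_mem_zero_prod _ le_rfl, if_pos (Nat.le_add_left 1 J), map_one, map_pow,
    stepSeries]
  ring

theorem map_partitionSum_pow_sup {B : Type*} [CommRing B] {ψ : R⟦X⟧ →+* B} {N : ℕ}
    (hψ : ψ X ^ N = 0) (z : R) :
    ψ (partitionSum fun s => z ^ s.sup) = ψ (weightSeries fun _ => z) := by
  have hsup (m : ℕ) : ψ (partitionSum fun s => if s.sup = m then z ^ s.sup else 0) =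
      ψ (stepSeries 1 0 m) * (ψ (C z) * ψ X) ^ m := by
    have hpow (s : Multiset ℕ) : (if s.sup = m then z ^ s.sup else 0) =
        z ^ m * if s.sup = m then 1 else 0 := by
      split_ifs with h <;> simp [h]
    rw [funext hpow, partitionSum_const_mul, partitionSum_ite_sup_eq]
    simp only [map_mul, map_pow]
    ring
  have hbinom := qPochhammer_mul_sum_range (a := 0) (c := fun m => ψ (stepSeries 1 0 m)) hψ
    (t := ψ (C z) * ψ X) (by rw [mul_pow, hψ, mul_zero]) fun m => by
      simpa using congrArg ψ (one_sub_mul_stepSeries_succ 1 0 m)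
  have hA := qPochhammer_mul_map_weightSeries hψ z
  have hzero : qPochhammer (0 * (ψ (C z) * ψ X)) (ψ X) N = 1 := by simp [qPochhammer]
  rw [hzero, stepSeries_zero, weightSeries_zero, map_one, mul_one] at hbinom
  rw [map_partitionSum_eq_sum_fiber hψ _ fun p => Multiset.sup_le.mpr fun _ => p.le_of_mem_parts,
    sum_congr rfl fun m _ => hsup m]
  set S := ∑ m ∈ range N, ψ (stepSeries 1 0 m) * (ψ (C z) * ψ X) ^ m
  linear_combination ψ (weightSeries fun _ => z) * hbinom - S * hA

/-- The `J`-th summand comes from the partitions with `J` ones. -/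
theorem map_crankSeries {B : Type*} [CommRing B] {ψ : R⟦X⟧ →+* B} {N : ℕ} (hψ : ψ X ^ N = 0)
    (z : Rˣ) : ψ (crankSeries z) = (1 - ψ X) *
      ∑ J ∈ range N, ψ (stepSeries 1 (z : R) J) * (ψ (C ((z⁻¹ : Rˣ) : R)) * ψ X) ^ J := by
  have hcount {n : ℕ} (p : n.Partition) : p.parts.count 1 ≤ n := by
    have hcard := Multiset.card_nsmul_le_sum (a := 1) fun _ => p.parts_pos
    rw [smul_eq_mul, mul_one, p.parts_sum] at hcard
    exact (Multiset.count_le_card 1 _).trans hcard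
  rw [crankSeries_eq, map_add, map_partitionSum_eq_sum_fiber hψ (crankWeight z) hcount]
  rcases N with _ | N
  · have : Subsingleton B := subsingleton_of_zero_eq_one (by simpa using hψ.symm)
    exact Subsingleton.elim _ _
  · simp only [sum_range_succ', partitionSum_crankWeight_count_succ,
      partitionSum_crankWeight_count_zero, map_sub, map_mul, map_pow, map_one,
      map_partitionSum_pow_sup hψ, stepSeries_zero, ← mul_sum]
    ring

/-- The **Andrews–Garvan identity**, with the infinite products expressed by `weightSeries`. -/
theorem crankSeries_mul_weightSeries_one (z : Rˣ) :
    crankSeries z * (weightSeries fun _ => 1) =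
      (weightSeries fun _ => (z : R)) * weightSeries fun _ => ((z⁻¹ : Rˣ) : R) := by
  refine eq_of_forall_mk_span_X_pow_eq fun N => ?_
  have hψ := mk_span_X_pow_pow_eq_zero (R := R) N
  set ψ := Ideal.Quotient.mk (Ideal.span {(X : R⟦X⟧) ^ N})
  have hzw : ψ (C (z : R)) * ψ (C ((z⁻¹ : Rˣ) : R)) = 1 := by
    rw [← map_mul, ← map_mul, z.mul_inv, map_one, map_one]
  have hbinom := qPochhammer_mul_sum_range (a := ψ (C (z : R)) * ψ X)
    (t := ψ (C ((z⁻¹ : Rˣ) : R)) * ψ X) (c := fun J => ψ (stepSeries 1 (z : R) J)) hψ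
    (by rw [mul_pow, hψ, mul_zero]) fun J => by
      simpa [pow_succ', mul_assoc] using congrArg ψ (one_sub_mul_stepSeries_succ 1 (z : R) J)
  have hw := qPochhammer_mul_map_weightSeries hψ ((z⁻¹ : Rˣ) : R)
  have hone := qPochhammer_mul_map_weightSeries hψ (1 : R)
  have hshift := one_sub_mul_qPochhammer (ψ X) N
  rw [mul_mul_mul_comm, hzw, one_mul, stepSeries_zero] at hbinom
  rw [hψ, mul_zero, sub_zero, mul_one] at hshift
  rw [map_one, map_one, one_mul] at hone
  rw [map_mul, map_mul, map_crankSeries hψ]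
  set S := ∑ J ∈ range N, ψ (stepSeries 1 (z : R) J) * (ψ (C ((z⁻¹ : Rˣ) : R)) * ψ X) ^ J
  set A₁ := ψ (weightSeries fun _ => 1)
  set A := ψ (weightSeries fun _ => (z : R))
  set A' := ψ (weightSeries fun _ => ((z⁻¹ : Rˣ) : R))
  linear_combination -(1 - ψ X) * S * A₁ * hw + (1 - ψ X) * A₁ * A' * hbinom +
    A₁ * A' * A * hshift + A * A' * hone

end CrankSeries

section LogDerivative

variable {R : Type*} [CommRing R]

/-- The derivation of `R⟦X⟧` that applies a derivation of `R` to each coefficient. -/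
noncomputable def coeffDerivation {K : Type*} [CommRing K] [Algebra K R] (d : Derivation K R R) :
    Derivation K R⟦X⟧ R⟦X⟧ :=
  .mk'
    { toFun := fun f => .mk fun n => d (coeff n f)
      map_add' := fun f g => by ext n; simp
      map_smul' := fun c f => by ext n; simp [LinearMap.map_smul_of_tower] }
    fun f g => by
      ext n
      simp only [LinearMap.coe_mk, AddHom.coe_mk, coeff_mk, coeff_mul, map_sum, Derivation.leibniz,
        smul_eq_mul, map_add, sum_add_distrib]
      rw [← Nat.sum_antidiagonal_swap (f := fun x => coeff x.1 g * d (coeff x.2 f))]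
      rfl

theorem coeff_coeffDerivation {K : Type*} [CommRing K] [Algebra K R] (d : Derivation K R R)
    (f : R⟦X⟧) (n : ℕ) : coeff n (coeffDerivation d f) = d (coeff n f) := by
  simp [coeffDerivation]

/-- The series `∑_{m ≥ 1} z ^ m * X ^ (a * m)`. -/
noncomputable def geomTail (z : R) (a : ℕ) : R⟦X⟧ :=
  .mk fun n => if a ∣ n ∧ n ≠ 0 then z ^ (n / a) else 0

theorem one_sub_mul_geomTail_add_one (z : R) {a : ℕ} (ha : a ≠ 0) :
    (1 - C z * X ^ a) * (geomTail z a + 1) = 1 := by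
  have hgeom : (1 - C z * X) * (PowerSeries.mk fun m => z ^ m) = 1 := by
    ext (_ | n)
    · simp
    · simp [sub_mul, mul_assoc, coeff_one, pow_succ']
  have hexpand : expand a ha (.mk fun m => z ^ m) = geomTail z a + 1 := by
    ext n
    rcases eq_or_ne n 0 with rfl | hn <;> simp [geomTail, coeff_expand, coeff_one, *]
  simpa only [map_mul, map_sub, map_one, expand_C, expand_X, hexpand] using
    congrArg (expand a ha) hgeom

theorem sum_coeff_geomTail (z : R) {k n : ℕ} (h : k ≤ n) :
    ∑ a ∈ Icc 1 n, coeff k (geomTail z a) = ∑ m ∈ k.divisors, z ^ m := by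
  rcases eq_or_ne k 0 with rfl | hk
  · simp [geomTail]
  · have hdivisors : {a ∈ Icc 1 n | a ∣ k} = k.divisors := by
      ext a
      simp only [mem_filter, mem_Icc, Nat.mem_divisors]
      exact ⟨fun ha => ⟨ha.2, hk⟩, fun ha => ⟨⟨Nat.pos_of_dvd_of_pos ha.1 hk.bot_lt,
        (Nat.le_of_dvd hk.bot_lt ha.1).trans h⟩, ha.1⟩⟩
    simp only [geomTail, coeff_mk, hk, ne_eq, not_false_iff, and_true]
    rw [← sum_filter, hdivisors, Nat.sum_div_divisors k fun m => z ^ m]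

theorem partitionSum_count_mul_pow_card (z : R) {a : ℕ} (ha : a ≠ 0) :
    (partitionSum fun s => s.count a * z ^ s.card) =
      geomTail z a * weightSeries fun _ => z := by
  have hmark := partitionSum_count_mul (Nat.one_le_iff_ne_zero.mpr ha) fun s => z ^ s.card
  have hcons (s : Multiset ℕ) : (s.count a + 1) * z ^ (a ::ₘ s).card =
      z * (s.count a * z ^ s.card + (s.map fun _ => z).prod) := by
    rw [Multiset.card_cons, Multiset.map_const', Multiset.prod_replicate, pow_succ']
    ring
  rw [funext hcons, partitionSum_const_mul, partitionSum_add, ← weightSeries] at hmark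
  have hgeom := one_sub_mul_geomTail_add_one z ha
  set T := partitionSum fun s => s.count a * z ^ s.card
  set A := weightSeries fun _ => z
  linear_combination (geomTail z a + 1) * hmark - (T + A) * hgeom

/-- The series `∑ₙ (∑_{m ∣ n} z ^ m) Xⁿ`. -/
noncomputable def divisorPowSeries (z : R) : R⟦X⟧ :=
  .mk fun n => ∑ m ∈ n.divisors, z ^ m

theorem coeffDerivation_weightSeries {K : Type*} [CommRing K] [Algebra K R]
    (d : Derivation K R R) {z ε : R} (hz : d z = ε * z) :
    coeffDerivation d (weightSeries fun _ => z) =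
      C ε * ((weightSeries fun _ => z) * divisorPowSeries z) := by
  have hpow (m : ℕ) : d (z ^ m) = ε * (m * z ^ m) := by
    rw [Derivation.leibniz_pow, hz, nsmul_eq_mul, smul_eq_mul]
    rcases m with _ | m
    · simp
    · rw [Nat.add_sub_cancel, pow_succ]
      ring
  have hcard (n : ℕ) : coeff n (coeffDerivation d (weightSeries fun _ => z)) =
      ε * coeff n (partitionSum fun s => (s.map fun _ => (1 : R)).sum * z ^ s.card) := by
    simp only [coeff_coeffDerivation, weightSeries, coeff_partitionSum, map_sum, mul_sum,
      Multiset.map_const', Multiset.prod_replicate, Multiset.sum_replicate, hpow, nsmul_one]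
  ext n
  rw [hcard, coeff_C_mul, coeff_partitionSum_sum_map_mul, mul_comm (weightSeries _), coeff_mul]
  congr 1
  calc ∑ a ∈ Icc 1 n, 1 * coeff n (partitionSum fun s => s.count a * z ^ s.card)
      = ∑ a ∈ Icc 1 n, ∑ x ∈ antidiagonal n,
          coeff x.1 (geomTail z a) * coeff x.2 (weightSeries fun _ => z) :=
        sum_congr rfl fun a ha => by
          have ha0 : a ≠ 0 := Nat.one_le_iff_ne_zero.mp (mem_Icc.mp ha).1
          rw [one_mul, partitionSum_count_mul_pow_card z ha0, coeff_mul]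
    _ = _ := by
        rw [sum_comm]
        refine sum_congr rfl fun x hx => ?_
        rw [← sum_mul, sum_coeff_geomTail z (HasAntidiagonal.antidiagonal.fst_le hx),
          divisorPowSeries, coeff_mk]

theorem isUnit_weightSeries (x : ℕ → R) : IsUnit (weightSeries x) := by
  rw [isUnit_iff_constantCoeff, ← coeff_zero_eq_constantCoeff_apply, coeff_zero_weightSeries]
  exact isUnit_one

/-- The logarithmic derivative in `z` of the Andrews–Garvan identity. -/
theorem coeffDerivation_crankSeries {K : Type*} [CommRing K] [Algebra K R]
    (d : Derivation K R R) {z : Rˣ} (hz : d z = z) :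
    coeffDerivation d (crankSeries z) =
      crankSeries z * (divisorPowSeries (z : R) - divisorPowSeries ((z⁻¹ : Rˣ) : R)) := by
  have hz_inv : d ((z⁻¹ : Rˣ) : R) = -1 * ((z⁻¹ : Rˣ) : R) := by
    have hleibniz := d.leibniz (z : R) ((z⁻¹ : Rˣ) : R)
    rw [z.mul_inv, d.map_one_eq_zero, hz, smul_eq_mul, smul_eq_mul, z.inv_mul] at hleibniz
    linear_combination -((z⁻¹ : Rˣ) : R) * hleibniz - d ((z⁻¹ : Rˣ) : R) * z.inv_mul
  have hgarvan := crankSeries_mul_weightSeries_one z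
  have hderiv := congrArg (coeffDerivation d) hgarvan
  rw [Derivation.leibniz, Derivation.leibniz,
    coeffDerivation_weightSeries d (z := (z : R)) (ε := 1) (by rw [hz, one_mul]),
    coeffDerivation_weightSeries d hz_inv,
    coeffDerivation_weightSeries d (z := 1) (ε := 0) (by rw [d.map_one_eq_zero, zero_mul])]
    at hderiv
  simp only [smul_eq_mul, map_zero, map_one, map_neg, zero_mul, mul_zero, one_mul, zero_add]
    at hderiv
  refine (isUnit_weightSeries fun _ => (1 : R)).mul_left_cancel ?_
  linear_combination hderiv -
    (divisorPowSeries (z : R) - divisorPowSeries ((z⁻¹ : Rˣ) : R)) * hgarvan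

end LogDerivative

section Moments

/-- The exponential series as a unit of `ℂ⟦X⟧`: the value `z = exp u` at which the crank
generating function becomes the exponential generating function of the crank moments. -/
noncomputable def expUnit : ℂ⟦X⟧ˣ where
  val := exp ℂ
  inv := evalNegHom (exp ℂ)
  val_inv := exp_mul_exp_neg_eq_one
  inv_val := by rw [mul_comm, exp_mul_exp_neg_eq_one]

theorem coeff_expUnit_zpow (m : ℤ) (k : ℕ) :
    coeff k ((expUnit ^ m : ℂ⟦X⟧ˣ) : ℂ⟦X⟧) = (m : ℂ) ^ k / k ! := by
  obtain ⟨a, rfl | rfl⟩ := m.eq_nat_or_neg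
  · rw [zpow_natCast, Units.val_pow_eq_pow_val]
    simp [expUnit, exp_pow_eq_rescale_exp, coeff_rescale, coeff_exp, div_eq_mul_inv]
  · have hinv : ((expUnit ^ (-(a : ℤ)) : ℂ⟦X⟧ˣ) : ℂ⟦X⟧) = evalNegHom (exp ℂ ^ a) := by
      rw [zpow_neg, zpow_natCast, ← inv_pow, Units.val_pow_eq_pow_val, map_pow]
      rfl
    rw [hinv, exp_pow_eq_rescale_exp, evalNegHom, coeff_rescale, coeff_rescale, coeff_exp,
      Int.cast_neg, Int.cast_natCast, neg_pow (a : ℂ)]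
    simp [div_eq_mul_inv, mul_assoc]

theorem crankMomentCoeff_eq (k n : ℕ) : crankMomentCoeff k n =
    if n = 1 then 1 + (-1) ^ k - 0 ^ k else ∑ p : n.Partition, crank p ^ k := by
  simpa only [crankMomentCoeff, smul_eq_mul, mul_comm, one_pow] using
    finsum_crankCount_zsmul n fun m : ℤ => m ^ k

theorem crankMomentCoeff_zero (n : ℕ) : crankMomentCoeff 0 n = Fintype.card n.Partition := by
  rw [crankMomentCoeff_eq]
  split_ifs with hn
  · subst hn
    simp
  · simp

theorem coeff_coeff_crankSeries_expUnit (k n : ℕ) :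
    coeff k (coeff n (crankSeries expUnit)) = (crankMomentCoeff k n : ℂ) / k ! := by
  rw [crankSeries, coeff_mk, finsum_crankCount_zsmul, crankMomentCoeff_eq]
  split_ifs
  · simp only [map_sub, map_add, coeff_expUnit_zpow]
    push_cast
    ring
  · simp only [map_sum, coeff_expUnit_zpow, Int.cast_sum, Int.cast_pow, sum_div]

/-- The generating function `∑ₙ (∑ₘ m ^ k M(m, n)) / k! Xⁿ` of the `k`-th crank moments. -/
noncomputable def momentSeries (k : ℕ) : ℂ⟦X⟧ :=
  .mk fun n => (crankMomentCoeff k n : ℂ) / k !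

/-- The coefficient of `u ^ j` in `divisorPowSeries (exp u) - divisorPowSeries (exp (-u))`. -/
noncomputable def signedDivisorSeries (j : ℕ) : ℂ⟦X⟧ :=
  .mk fun n => ∑ m ∈ n.divisors, ((m : ℂ) ^ j - (-m) ^ j) / j !

theorem momentSeries_succ (k : ℕ) :
    (k + 1 : ℂ) • momentSeries (k + 1) =
      ∑ x ∈ antidiagonal k, momentSeries x.1 * signedDivisorSeries x.2 := by
  have hdivisor (j n : ℕ) :
      coeff j (coeff n (divisorPowSeries (expUnit : ℂ⟦X⟧) -
        divisorPowSeries ((expUnit⁻¹ : ℂ⟦X⟧ˣ) : ℂ⟦X⟧))) = coeff n (signedDivisorSeries j) := by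
    have hpow := coeff_expUnit_zpow
    simp only [divisorPowSeries, signedDivisorSeries, map_sub, coeff_mk, map_sum, sub_div,
      sum_sub_distrib]
    congr 1 <;> refine sum_congr rfl fun m _ => ?_
    · simpa using hpow m j
    · simpa using hpow (-m) j
  ext n
  -- Compare the coefficients of `u ^ k` in the logarithmic derivative at `z = exp u`.
  have h := congrArg (fun f => coeff k (coeff n f))
    (coeffDerivation_crankSeries (d⁄dX ℂ) (z := expUnit) (derivative_exp ℂ))
  simp only [coeff_coeffDerivation, coeff_derivative, coeff_coeff_crankSeries_expUnit] at h
  simp only [coeff_mul, map_sum, hdivisor, coeff_coeff_crankSeries_expUnit] at h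
  rw [sum_comm] at h
  simp only [map_smul, map_sum, coeff_mul, momentSeries, coeff_mk, smul_eq_mul,
    mul_comm (k + 1 : ℂ), h]

theorem signedDivisorSeries_of_even {j : ℕ} (hj : Even j) : signedDivisorSeries j = 0 := by
  ext n
  simp [signedDivisorSeries, hj.neg_pow]

theorem coeff_signedDivisorSeries_of_odd {j : ℕ} (hj : Odd j) (n : ℕ) :
    coeff n (signedDivisorSeries j) = 2 / j ! * ArithmeticFunction.sigma j n := by
  rw [signedDivisorSeries, coeff_mk, ArithmeticFunction.sigma_apply]
  push_cast
  rw [mul_sum]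
  refine sum_congr rfl fun m _ => ?_
  rw [hj.neg_pow]
  ring

end Moments

section PartitionGeneratingFunction

open Filter Topology

variable {𝕜 : Type*} [RCLike 𝕜] {q : 𝕜}

theorem hasSum_coeff_mul {f g : 𝕜⟦X⟧} {a b : 𝕜} (hf : HasSum (fun n => coeff n f * q ^ n) a)
    (hg : HasSum (fun n => coeff n g * q ^ n) b) :
    HasSum (fun n => coeff n (f * g) * q ^ n) (a * b) := by
  have hf' := summable_norm_iff.mpr hf.summable
  have hg' := summable_norm_iff.mpr hg.summable
  have hcoeff (n : ℕ) : coeff n (f * g) * q ^ n =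
      ∑ x ∈ antidiagonal n, coeff x.1 f * q ^ x.1 * (coeff x.2 g * q ^ x.2) := by
    rw [coeff_mul, sum_mul]
    refine sum_congr rfl fun x hx => ?_
    rw [← mem_antidiagonal.mp hx, pow_add]
    ring
  rw [funext hcoeff, ← hf.tsum_eq, ← hg.tsum_eq,
    tsum_mul_tsum_eq_tsum_sum_antidiagonal_of_summable_norm hf' hg']
  exact (summable_norm_sum_mul_antidiagonal_of_summable_norm hf' hg').of_norm.hasSum

theorem hasSum_coeff_geomTail_add_one (hq : ‖q‖ < 1) {a : ℕ} (ha : a ≠ 0) :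
    HasSum (fun n => coeff n (geomTail (1 : 𝕜) a + 1) * q ^ n) (1 - q ^ a)⁻¹ := by
  have hqa : ‖q ^ a‖ < 1 := norm_pow q a ▸ pow_lt_one₀ (norm_nonneg q) hq ha
  rw [← (mul_right_injective₀ ha).hasSum_iff]
  · convert hasSum_geometric_of_norm_lt_one hqa using 2 with m
    rcases eq_or_ne m 0 with rfl | hm <;> simp [geomTail, coeff_one, pow_mul, *]
  · intro n hn
    have hdvd : ¬a ∣ n := fun ⟨m, hm⟩ => hn ⟨m, hm.symm⟩
    have hn0 : n ≠ 0 := fun h => hdvd (h ▸ dvd_zero a)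
    simp [geomTail, coeff_one, hdvd, hn0]

theorem hasSum_coeff_stepSeries (hq : ‖q‖ < 1) (N : ℕ) :
    HasSum (fun n => coeff n (stepSeries (1 : 𝕜) 0 N) * q ^ n)
      (∏ i ∈ range N, (1 - q ^ (i + 1)))⁻¹ := by
  induction N with
  | zero =>
    rw [stepSeries_zero, weightSeries_zero]
    convert hasSum_ite_eq (0 : ℕ) (1 : 𝕜) using 2 with n
    · rcases eq_or_ne n 0 with rfl | hn <;> simp [coeff_one, *]
    · simp
  | succ N ih =>
    have hstep := one_sub_mul_stepSeries_succ (1 : 𝕜) 0 N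
    have hgeom := one_sub_mul_geomTail_add_one (1 : 𝕜) N.succ_ne_zero
    rw [map_zero, zero_mul, sub_zero, one_mul] at hstep
    have hmul : stepSeries (1 : 𝕜) 0 (N + 1) = stepSeries 1 0 N * (geomTail 1 (N + 1) + 1) := by
      rw [← hstep, mul_right_comm, hgeom, one_mul]
    rw [hmul, prod_range_succ, mul_inv]
    exact hasSum_coeff_mul ih (hasSum_coeff_geomTail_add_one hq N.succ_ne_zero)

theorem coeff_stepSeries_one_zero (N n : ℕ) :
    coeff n (stepSeries (1 : 𝕜) 0 N) = #{p : n.Partition | p.parts.sup ≤ N} := by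
  rw [stepSeries_one_zero, coeff_partitionSum, sum_boole]

theorem coeff_stepSeries_one_zero_of_le {N n : ℕ} (h : n ≤ N) :
    coeff n (stepSeries (1 : 𝕜) 0 N) = Fintype.card n.Partition := by
  rw [coeff_stepSeries_of_le _ _ h, weightSeries, coeff_partitionSum]
  simp

theorem summable_norm_neg_pow_succ (hq : ‖q‖ < 1) : Summable fun n : ℕ => ‖-q ^ (n + 1)‖ := by
  simpa using (summable_nat_add_iff 1).mpr (summable_geometric_of_lt_one (norm_nonneg q) hq)

theorem tprod_one_sub_pow_ne_zero (hq : ‖q‖ < 1) : ∏' n : ℕ, (1 - q ^ (n + 1)) ≠ 0 := by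
  simp only [sub_eq_add_neg]
  refine tprod_one_add_ne_zero_of_summable (fun i h => ?_) (summable_norm_neg_pow_succ hq)
  have hlt := pow_lt_one₀ (norm_nonneg q) hq i.succ_ne_zero
  rw [← sub_eq_add_neg, sub_eq_zero] at h
  rw [← norm_pow, Nat.succ_eq_add_one, ← h, norm_one] at hlt
  exact lt_irrefl _ hlt

theorem tendsto_inv_prod_one_sub_pow (hq : ‖q‖ < 1) :
    Tendsto (fun N => (∏ i ∈ range N, (1 - q ^ (i + 1)))⁻¹) atTop
      (𝓝 (∏' n : ℕ, (1 - q ^ (n + 1)))⁻¹) := by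
  refine Tendsto.inv₀ (Multipliable.hasProd ?_).tendsto_prod_nat (tprod_one_sub_pow_ne_zero hq)
  simp only [sub_eq_add_neg]
  exact multipliable_one_add_of_summable (summable_norm_neg_pow_succ hq)

theorem summable_card_partition {r : ℝ} (h0 : 0 ≤ r) (h1 : r < 1) :
    Summable fun n : ℕ => (Fintype.card n.Partition : ℝ) * r ^ n := by
  have hr : ‖r‖ < 1 := by rwa [Real.norm_of_nonneg h0]
  obtain ⟨c, hc⟩ := (tendsto_inv_prod_one_sub_pow hr).bddAbove_range
  refine summable_of_sum_range_le (c := c) (fun n => by positivity) fun M => ?_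
  calc ∑ n ∈ range M, (Fintype.card n.Partition : ℝ) * r ^ n
      = ∑ n ∈ range M, coeff n (stepSeries (1 : ℝ) 0 M) * r ^ n :=
        sum_congr rfl fun n hn => by
          rw [coeff_stepSeries_one_zero_of_le (mem_range.mp hn).le]
    _ ≤ (∏ i ∈ range M, (1 - r ^ (i + 1)))⁻¹ :=
        sum_le_hasSum (range M) (fun n _ => by rw [coeff_stepSeries_one_zero]; positivity)
          (hasSum_coeff_stepSeries hr M)
    _ ≤ c := hc ⟨M, rfl⟩

theorem hasSum_card_partition (hq : ‖q‖ < 1) :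
    HasSum (fun n : ℕ => (Fintype.card n.Partition : 𝕜) * q ^ n)
      (∏' n : ℕ, (1 - q ^ (n + 1)))⁻¹ := by
  have hbound := summable_card_partition (norm_nonneg q) hq
  have hlim := tendsto_tsum_of_dominated_convergence (𝓕 := atTop)
    (f := fun N n => coeff n (stepSeries (1 : 𝕜) 0 N) * q ^ n)
    (g := fun n => (Fintype.card n.Partition : 𝕜) * q ^ n) hbound
    (fun n => tendsto_const_nhds.congr' <| (eventually_ge_atTop n).mono fun N hN => by
      simp only [coeff_stepSeries_one_zero_of_le hN])
    (.of_forall fun N n => by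
      rw [coeff_stepSeries_one_zero, norm_mul, norm_pow, RCLike.norm_natCast]
      gcongr
      exact card_le_univ _)
  simp only [(hasSum_coeff_stepSeries hq _).tsum_eq] at hlim
  rw [← tendsto_nhds_unique hlim (tendsto_inv_prod_one_sub_pow hq)]
  exact (Summable.of_norm (by simpa using hbound)).hasSum

end PartitionGeneratingFunction

section NormalizedMoments

variable {q : ℂ}

theorem summable_sigma_mul_pow (hq : ‖q‖ < 1) (k : ℕ) :
    Summable fun n : ℕ => (ArithmeticFunction.sigma k n : ℂ) * q ^ n := by
  refine .of_norm_bounded (summable_norm_pow_mul_geometric_of_norm_lt_one (k + 1) hq) fun n => ?_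
  simp only [norm_mul, Complex.norm_natCast, norm_pow]
  gcongr
  exact_mod_cast ArithmeticFunction.sigma_le_pow_succ k n

/-- The Eisenstein series `G_{2j}` without its constant term, as a function of `q`. -/
noncomputable def eisensteinTail (j : ℕ) (q : ℂ) : ℂ :=
  ∑' n : ℕ, (ArithmeticFunction.sigma (2 * j - 1) (n + 1) : ℂ) * q ^ (n + 1)

theorem hasSum_coeff_signedDivisorSeries_odd (hq : ‖q‖ < 1) (i : ℕ) :
    HasSum (fun n => coeff n (signedDivisorSeries (2 * i + 1)) * q ^ n)
      (2 / (2 * i + 1)! * eisensteinTail (i + 1) q) := by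
  have hσ := summable_sigma_mul_pow hq (2 * i + 1)
  have htail : eisensteinTail (i + 1) q =
      ∑' n : ℕ, (ArithmeticFunction.sigma (2 * i + 1) n : ℂ) * q ^ n := by
    rw [hσ.tsum_eq_zero_add, eisensteinTail]
    simp [mul_add]
  simp only [coeff_signedDivisorSeries_of_odd (odd_two_mul_add_one i), mul_assoc, htail]
  exact hσ.hasSum.mul_left _

theorem summable_coeff_signedDivisorSeries (hq : ‖q‖ < 1) (j : ℕ) :
    Summable fun n => coeff n (signedDivisorSeries j) * q ^ n := by
  rcases j.even_or_odd with hj | ⟨i, rfl⟩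
  · simp [signedDivisorSeries_of_even hj]
  · exact (hasSum_coeff_signedDivisorSeries_odd hq i).summable

theorem hasSum_coeff_momentSeries_succ {k : ℕ} {c d : ℕ → ℂ}
    (hc : ∀ j ≤ k, HasSum (fun n => coeff n (momentSeries j) * q ^ n) (c j))
    (hd : ∀ j ≤ k, HasSum (fun n => coeff n (signedDivisorSeries j) * q ^ n) (d j)) :
    HasSum (fun n => (k + 1) * (coeff n (momentSeries (k + 1)) * q ^ n))
      (∑ x ∈ antidiagonal k, c x.1 * d x.2) := by
  have hcoeff (n : ℕ) : (k + 1) * (coeff n (momentSeries (k + 1)) * q ^ n) =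
      ∑ x ∈ antidiagonal k, coeff n (momentSeries x.1 * signedDivisorSeries x.2) * q ^ n := by
    rw [← sum_mul, ← map_sum, ← momentSeries_succ, map_smul, smul_eq_mul, mul_assoc]
  rw [funext hcoeff]
  exact hasSum_sum fun x hx => hasSum_coeff_mul
    (hc x.1 (HasAntidiagonal.antidiagonal.fst_le hx))
    (hd x.2 (HasAntidiagonal.antidiagonal.snd_le hx))

theorem summable_coeff_momentSeries (hq : ‖q‖ < 1) (k : ℕ) :
    Summable fun n => coeff n (momentSeries k) * q ^ n := by
  induction k using Nat.strong_induction_on with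
  | _ k ih =>
    rcases k with _ | k
    · simpa [momentSeries, crankMomentCoeff_zero] using (hasSum_card_partition hq).summable
    · have hsucc := hasSum_coeff_momentSeries_succ
        (fun j hj => (ih j (Nat.lt_succ_of_le hj)).hasSum)
        fun j _ => (summable_coeff_signedDivisorSeries hq j).hasSum
      exact (summable_mul_left_iff k.cast_add_one_ne_zero).mp hsucc.summable

theorem summable_crankMomentCoeff (hq : ‖q‖ < 1) (k : ℕ) :
    Summable fun n => (crankMomentCoeff k n : ℂ) * q ^ n := by
  refine ((summable_coeff_momentSeries hq k).mul_left (k ! : ℂ)).congr fun n => ?_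
  rw [momentSeries, coeff_mk, ← mul_assoc,
    mul_div_cancel₀ _ (Nat.cast_ne_zero.mpr k.factorial_ne_zero)]

theorem hasSum_coeff_momentSeries (hq : ‖q‖ < 1) (k : ℕ) :
    HasSum (fun n => coeff n (momentSeries k) * q ^ n) (crankMoment k q / k !) := by
  simp only [momentSeries, coeff_mk, div_mul_eq_mul_div]
  exact (summable_crankMomentCoeff hq k).hasSum.div_const _

theorem sum_antidiagonal_two_mul_add_one {M : Type*} [AddCommMonoid M] {f : ℕ × ℕ → M}
    (hf : ∀ x, Even x.2 → f x = 0) (n : ℕ) :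
    ∑ x ∈ antidiagonal (2 * n + 1), f x =
      ∑ x ∈ antidiagonal n, f (2 * x.2, 2 * x.1 + 1) := by
  refine (sum_of_injOn (fun x : ℕ × ℕ => (2 * x.2, 2 * x.1 + 1)) ?_ ?_ ?_ fun _ _ => rfl).symm
  · intro x _ y _ hxy
    simp only [Prod.mk.injEq] at hxy
    exact Prod.ext (by omega) (by omega)
  · intro x hx
    rw [mem_coe, HasAntidiagonal.mem_antidiagonal] at hx ⊢
    dsimp only
    omega
  · rintro ⟨a, b⟩ hx hx'
    refine hf _ (Nat.not_odd_iff_even.mp fun ⟨i, hi⟩ => hx' ?_)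
    rw [HasAntidiagonal.mem_antidiagonal] at hx
    dsimp only at hx hi
    refine ⟨(i, n - i), ?_, Prod.ext (by dsimp only; omega) hi.symm⟩
    rw [mem_coe, HasAntidiagonal.mem_antidiagonal]
    dsimp only
    omega

theorem crankMoment_two_mul_succ (hq : ‖q‖ < 1) (n : ℕ) :
    (2 * n + 2) * (crankMoment (2 * (n + 1)) q / (2 * (n + 1))!) =
      ∑ x ∈ antidiagonal n, crankMoment (2 * x.2) q / (2 * x.2)! *
        (2 / (2 * x.1 + 1)! * eisensteinTail (x.1 + 1) q) := by
  have hsum := hasSum_coeff_momentSeries_succ (k := 2 * n + 1)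
    (fun j _ => hasSum_coeff_momentSeries hq j)
    fun j _ => (summable_coeff_signedDivisorSeries hq j).hasSum
  rw [sum_antidiagonal_two_mul_add_one fun x hx => by simp [signedDivisorSeries_of_even hx]] at hsum
  simp only [(hasSum_coeff_signedDivisorSeries_odd hq _).tsum_eq] at hsum
  convert ((hasSum_coeff_momentSeries hq (2 * (n + 1))).mul_left _).unique hsum using 2
  push_cast
  ring

theorem normalizedCrankMoment_zero (hq : ‖q‖ < 1) : normalizedCrankMoment 0 q = 1 := by
  simp only [normalizedCrankMoment, crankMoment, eulerProduct, crankMomentCoeff_zero,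
    Int.cast_natCast, (hasSum_card_partition hq).tsum_eq]
  exact mul_inv_cancel₀ (tprod_one_sub_pow_ne_zero hq)

/-- The generating function `∑ₙ 𝓒_{2n}(q) / (2n)! Xⁿ` of the even normalized crank moments. -/
noncomputable def normalizedMomentSeries (q : ℂ) : ℂ⟦X⟧ :=
  .mk fun n => normalizedCrankMoment (2 * n) q / (2 * n)!

/-- The generating function `∑ⱼ 2 (G_{2j} + B_{2j} / (4j)) / (2j)! X^j`, the logarithm of
`normalizedMomentSeries` up to its constant term. -/
noncomputable def eisensteinTailSeries (q : ℂ) : ℂ⟦X⟧ :=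
  .mk fun j => 2 * eisensteinTail j q / (2 * j)!

theorem derivative_normalizedMomentSeries (hq : ‖q‖ < 1) :
    d⁄dX ℂ (normalizedMomentSeries q) =
      d⁄dX ℂ (eisensteinTailSeries q) * normalizedMomentSeries q := by
  have hfac (i : ℕ) : (i + 1 : ℂ) / (2 * (i + 1))! = 1 / (2 * (2 * i + 1)!) := by
    have hi : (i + 1 : ℂ) ≠ 0 := i.cast_add_one_ne_zero
    rw [mul_add_one, Nat.factorial_succ (2 * i + 1)]
    push_cast
    rw [add_assoc, one_add_one_eq_two, ← mul_add_one]
    field_simp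
  ext n
  simp only [coeff_derivative, coeff_mul, normalizedMomentSeries, eisensteinTailSeries, coeff_mk,
    normalizedCrankMoment]
  calc eulerProduct q * crankMoment (2 * (n + 1)) q / (2 * (n + 1))! * (n + 1)
      = eulerProduct q / 2 *
          ((2 * n + 2) * (crankMoment (2 * (n + 1)) q / (2 * (n + 1))!)) := by ring
    _ = _ := by
        rw [crankMoment_two_mul_succ hq, mul_sum]
        refine sum_congr rfl fun x _ => ?_
        linear_combination -(2 * eisensteinTail (x.1 + 1) q *
          (eulerProduct q * crankMoment (2 * x.2) q / (2 * x.2)!)) * hfac x.1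

theorem coeff_zero_normalizedMomentSeries (hq : ‖q‖ < 1) :
    coeff 0 (normalizedMomentSeries q) = 1 := by
  simp [normalizedMomentSeries, normalizedCrankMoment_zero hq]

theorem normalizedCrankMoment_eq_partitionTrace (hq : ‖q‖ < 1) (k : ℕ) :
    normalizedCrankMoment (2 * k) q = partitionTrace k phiM fun j => eisensteinTail j q := by
  have hexp := eq_egfComp_one (coeff_zero_normalizedMomentSeries hq)
    (derivative_normalizedMomentSeries hq)
  rw [partitionTrace_phiM, ← eisensteinTailSeries, ← hexp, normalizedMomentSeries, coeff_mk,
    mul_div_cancel₀ _ (Nat.cast_ne_zero.mpr (Nat.factorial_ne_zero _))]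

theorem eisensteinTail_eq_partitionTrace (hq : ‖q‖ < 1) {k : ℕ} (hk : 1 ≤ k) :
    eisensteinTail k q = partitionTrace k phiS fun j => normalizedCrankMoment (2 * j) q := by
  have hlog := coeff_eq_coeff_egfComp_log (coeff_zero_normalizedMomentSeries hq)
    (derivative_normalizedMomentSeries hq) hk
  have hfac : ((2 * k)! : ℂ) ≠ 0 := Nat.cast_ne_zero.mpr (Nat.factorial_ne_zero _)
  rw [partitionTrace_phiS, ← normalizedMomentSeries, ← hlog, eisensteinTailSeries, coeff_mk]
  field_simp

end NormalizedMoments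

end CrankTrace

theorem corollary4p1 (k : ℕ) (hk : 1 ≤ k) (τ : UpperHalfPlane) :
    Multipliable (fun n : ℕ => 1 - CrankTrace.nome τ ^ (n + 1)) ∧
    Summable (fun n : ℕ =>
      (CrankTrace.crankMomentCoeff (2 * k) n : ℂ) * CrankTrace.nome τ ^ n) ∧
    Summable (fun n : ℕ =>
      (ArithmeticFunction.sigma (2 * k - 1) (n + 1) : ℂ) * CrankTrace.nome τ ^ (n + 1)) ∧
    CrankTrace.normalizedCrankMoment (2 * k) (CrankTrace.nome τ) =
      CrankTrace.partitionTrace k CrankTrace.phiM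
        (fun j => CrankTrace.eisensteinG j τ +
          ((bernoulli (2 * j) : ℚ) : ℂ) / (4 * (j : ℂ))) ∧
    CrankTrace.eisensteinG k τ =
      -((bernoulli (2 * k) : ℚ) : ℂ) / (4 * (k : ℂ)) +
        CrankTrace.partitionTrace k CrankTrace.phiS
          (fun j => CrankTrace.normalizedCrankMoment (2 * j) (CrankTrace.nome τ)) := by
  have hq : ‖CrankTrace.nome τ‖ < 1 := UpperHalfPlane.norm_exp_two_pi_I_lt_one τ
  have htail (j : ℕ) : CrankTrace.eisensteinG j τ + ((bernoulli (2 * j) : ℚ) : ℂ) / (4 * j) =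
      CrankTrace.eisensteinTail j (CrankTrace.nome τ) := by
    rw [CrankTrace.eisensteinG, CrankTrace.eisensteinTail]
    ring
  refine ⟨ModularForm.multipliable_one_sub_pow hq, CrankTrace.summable_crankMomentCoeff hq _,
    (summable_nat_add_iff 1).mpr (CrankTrace.summable_sigma_mul_pow hq _), ?_, ?_⟩
  · simpa only [htail] using CrankTrace.normalizedCrankMoment_eq_partitionTrace hq k
  · rw [← CrankTrace.eisensteinTail_eq_partitionTrace hq hk]
    rfl
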